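/- Let $K=\mathrm{GF}(q)$ be a finite field and $\sigma\neq\mathrm{id}$ an automorphism of $K$. Let $R=K(\varepsilon;\sigma)=K+K\varepsilon$ be the ring of twisted dual numbers, with multiplication $(a+b\varepsilon)(c+d\varepsilon)=ac+(ad+bc^{\sigma})\varepsilon$. The projective line $\mathbb P(R)$ is the set of left submodules $R(a,b)\le R^2$ such that $(a,b)$ is the first row of a matrix in $\mathrm{GL}_2(R)$; two points $R(a,b)$, $R(c,d)$ are parallel ($\parallel$) if $\begin{pmatrix}a&b\\c&d\end{pmatrix}\notin\mathrm{GL}_2(R)$. The blocks are the images under $\mathrm{GL}_2(R)$ of the base block $B_0=\mathbb P(K)\subseteq\mathbb P(R)$. Embed $R$ in the ring $M$ of $2\times2$ matrices over $K$ via $a+b\varepsilon\mapsto\begin{pmatrix}a&b\\0&a^{\sigma}\end{pmatrix}$, and thereby $\mathbb P(R)$ in $\mathbb P(M)$. Identify each point $M(A,B)$ of $\mathbb P(M)$ with the point $K(\widetilde BA,\det A,\det B)$ of the projective space $\mathrm{PG}(5,K)$ on $M\times K\times K=K^6$, where $\widetilde B$ is the adjugate of $B$ and a vector $\left(\begin{pmatrix}x_1&x_2\\x_3&x_4\end{pmatrix},x_5,x_6\right)$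 has coordinates $(x_1,\dots,x_6)$. Let $S=K(0,1,0,0,0,0)$, let $\mathbf H$ be the hyperplane $x_3=0$, and let $\mathcal C$ be the cone with vertex $S$ over $B_0$, i.e. the union of all lines joining $S$ with the points of $B_0$. A $3$-space of $\mathbf H$ is complementary to $S$ if it does not contain $S$ (so that together with $S$ it spans $\mathbf H$). Let $p_1,p_2,p_3\in\mathbb P(R)$ be pairwise non-parallel, and let $T$ be the intersection of all blocks through $p_1,p_2,p_3$. Then: (a) $p_1,p_2,p_3$ span a plane $\mathbf E$ of $\mathrm{PG}(5,K)$, and $T=\mathcal C\cap\mathbf E$. (b) For every point $x\in\mathbb P(R)$ with $x\nparallel p_1$, $x\nparallel p_2$ and $x\nparallel p_3$, the blocks through $p_1,p_2,p_3,x$ are exactly the intersections of $\mathcal C$ with those $3$-spaces of $\mathbf H$ that contain $\mathbf E$ and $x$ and are complementary to $S$. The number of these $3$-spaces is $q$ if $x\in T$; it is $0$ if $x\notin T$ but $x\parallel x'$ for some $x'\in T$; and it is $1$ otherwise. -/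

import Mathlib

open scoped LinearAlgebra.Projectivization MatrixGroups

namespace TwistedDD

/-- The ring `K(ε; σ)` of twisted dual numbers: the element `re + im • ε`. -/
@[ext]
structure TwistedDual {K : Type*} [Field K] (σ : K →+* K) where
  re : K
  im : K

namespace TwistedDual

variable {K : Type*} [Field K] {σ : K →+* K}

instance : Zero (TwistedDual σ) := ⟨⟨0, 0⟩⟩
instance : One (TwistedDual σ) := ⟨⟨1, 0⟩⟩
instance : Add (TwistedDual σ) := ⟨fun x y => ⟨x.re + y.re, x.im + y.im⟩⟩
instance : Neg (TwistedDual σ) := ⟨fun x => ⟨-x.re, -x.im⟩⟩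
/-- `(a + bε)(c + dε) = ac + (ad + b c^σ)ε`. -/
instance : Mul (TwistedDual σ) :=
  ⟨fun x y => ⟨x.re * y.re, x.re * y.im + x.im * σ y.re⟩⟩

@[simp] theorem zero_re : (0 : TwistedDual σ).re = 0 := rfl
@[simp] theorem zero_im : (0 : TwistedDual σ).im = 0 := rfl
@[simp] theorem one_re : (1 : TwistedDual σ).re = 1 := rfl
@[simp] theorem one_im : (1 : TwistedDual σ).im = 0 := rfl
@[simp] theorem add_re (x y : TwistedDual σ) : (x + y).re = x.re + y.re := rfl
@[simp] theorem add_im (x y : TwistedDual σ) : (x + y).im = x.im + y.im := rfl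
@[simp] theorem neg_re (x : TwistedDual σ) : (-x).re = -x.re := rfl
@[simp] theorem neg_im (x : TwistedDual σ) : (-x).im = -x.im := rfl
@[simp] theorem mul_re (x y : TwistedDual σ) : (x * y).re = x.re * y.re := rfl
@[simp] theorem mul_im (x y : TwistedDual σ) :
    (x * y).im = x.re * y.im + x.im * σ y.re := rfl

instance : Ring (TwistedDual σ) where
  add_assoc _ _ _ := by ext <;> simp [add_assoc]
  zero_add _ := by ext <;> simp
  add_zero _ := by ext <;> simp
  add_comm _ _ := by ext <;> simp [add_comm]
  neg_add_cancel _ := by ext <;> simp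
  mul_assoc _ _ _ := by ext <;> simp <;> ring
  one_mul _ := by ext <;> simp
  mul_one _ := by ext <;> simp
  zero_mul _ := by ext <;> simp
  mul_zero _ := by ext <;> simp
  left_distrib _ _ _ := by ext <;> simp <;> ring
  right_distrib _ _ _ := by ext <;> simp <;> ring
  nsmul := nsmulRec
  zsmul := zsmulRec

variable (σ)

/-- The subfield `K` of `K(ε; σ)`. -/
def ofField : K →+* TwistedDual σ where
  toFun a := ⟨a, 0⟩
  map_one' := rfl
  map_zero' := rfl
  map_mul' _ _ := by ext <;> simp
  map_add' _ _ := by ext <;> simp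

/-- The embedding of `K(ε; σ)` into the ring of `2 × 2` matrices over `K`. -/
def toMatrix : TwistedDual σ →+* Matrix (Fin 2) (Fin 2) K where
  toFun x := !![x.re, x.im; 0, σ x.re]
  map_one' := by ext i j; fin_cases i <;> fin_cases j <;> simp
  map_zero' := by ext i j; fin_cases i <;> fin_cases j <;> simp
  map_mul' _ _ := by
    ext i j; fin_cases i <;> fin_cases j <;> simp [Matrix.mul_apply, Fin.sum_univ_two]
  map_add' _ _ := by ext i j; fin_cases i <;> fin_cases j <;> simp

end TwistedDual

/-- The projective line over a ring `S`: the left submodules `S(a, b)` of `S²` such that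
`(a, b)` is the first row of an invertible `2 × 2` matrix. -/
def ProjLine (S : Type*) [Ring S] : Type _ :=
  {p : Submodule S (Fin 2 → S) // ∃ g : GL (Fin 2) S, p = Submodule.span S {g.1 0}}

namespace ProjLine

variable {S : Type*} [Ring S]

/-- `S(a, b) ∥ S(c, d)` iff the matrix with rows `(a, b)` and `(c, d)` is not invertible. -/
def Parallel (p r : ProjLine S) : Prop :=
  ¬ ∃ g : GL (Fin 2) S, p.1 = Submodule.span S {g.1 0} ∧ r.1 = Submodule.span S {g.1 1}

/-- The image `p^g` of a point under the (right) action of `GL₂(S)`: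
`S(a, b)` is mapped to `S((a, b) g)`. -/
def act (p : ProjLine S) (g : GL (Fin 2) S) : ProjLine S :=
  ⟨p.1.map (Matrix.vecMulLinear g.1), by
    obtain ⟨h, hh⟩ := p.2
    refine ⟨h * g, ?_⟩
    rw [hh, Submodule.map_span, Set.image_singleton]
    rfl⟩

theorem span_image_span {S' : Type*} [Ring S'] (f : S →+* S') (v : Fin 2 → S) :
    Submodule.span S' ((fun w : Fin 2 → S => (f ∘ w : Fin 2 → S')) ''
      (Submodule.span S {v} : Set (Fin 2 → S))) = Submodule.span S' {f ∘ v} := by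
  apply le_antisymm
  · rw [Submodule.span_le]
    rintro _ ⟨w, hw, rfl⟩
    obtain ⟨c, rfl⟩ := Submodule.mem_span_singleton.1 hw
    refine Submodule.mem_span_singleton.2 ⟨f c, ?_⟩
    ext i
    simp
  · rw [Submodule.span_le, Set.singleton_subset_iff]
    exact Submodule.subset_span ⟨v, Submodule.mem_span_singleton_self v, rfl⟩

/-- The map of projective lines `S(a, b) ↦ S'(f a, f b)` given by a ring homomorphism `f`. -/
def map {S' : Type*} [Ring S'] (f : S →+* S') (p : ProjLine S) : ProjLine S' :=
  ⟨Submodule.span S' ((fun w : Fin 2 → S => (f ∘ w : Fin 2 → S')) '' (p.1 : Set (Fin 2 → S))), by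
    obtain ⟨h, hh⟩ := p.2
    refine ⟨Units.map (f.mapMatrix (m := Fin 2)).toMonoidHom h, ?_⟩
    rw [hh, span_image_span]
    rfl⟩

end ProjLine

section Geometry

variable {K : Type*} [Field K]

/-- The vector `(B̃ A, det A, det B)` of `M × K × K = K⁶`, where `M` is the ring of `2 × 2`
matrices and `B̃` is the adjugate of `B`. -/
def hotjeVec (A B : Matrix (Fin 2) (Fin 2) K) : Fin 6 → K :=
  ![(B.adjugate * A) 0 0, (B.adjugate * A) 0 1, (B.adjugate * A) 1 0, (B.adjugate * A) 1 1,
    A.det, B.det]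

theorem hotjeVec_ne_zero (g : GL (Fin 2) (Matrix (Fin 2) (Fin 2) K)) :
    hotjeVec (g.1 0 0) (g.1 0 1) ≠ 0 := by
  intro h0
  set A := g.1 0 0 with hA
  set B := g.1 0 1 with hB
  have hdA : A.det = 0 := by simpa [hotjeVec] using congrFun h0 4
  have hdB : B.det = 0 := by simpa [hotjeVec] using congrFun h0 5
  have hBA : B.adjugate * A = 0 := by
    ext i j
    fin_cases i <;> fin_cases j
    · simpa [hotjeVec] using congrFun h0 0
    · simpa [hotjeVec] using congrFun h0 1
    · simpa [hotjeVec] using congrFun h0 2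
    · simpa [hotjeVec] using congrFun h0 3
  have h1 : A * g.2 0 0 + B * g.2 1 0 = 1 := by
    have := congrFun (congrFun g.3 0) 0
    simpa [Matrix.mul_apply, Fin.sum_univ_two] using this
  have h2 : B.adjugate = 0 := by
    calc B.adjugate = B.adjugate * (A * g.2 0 0 + B * g.2 1 0) := by rw [h1, mul_one]
      _ = 0 := by
        rw [mul_add, ← mul_assoc, ← mul_assoc, hBA, Matrix.adjugate_mul, hdB]
        simp
  have h3 : B = 0 := by
    rw [Matrix.adjugate_fin_two] at h2
    ext i j
    fin_cases i <;> fin_cases j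
    · simpa using congrFun (congrFun h2 1) 1
    · simpa using congrFun (congrFun h2 0) 1
    · simpa using congrFun (congrFun h2 1) 0
    · simpa using congrFun (congrFun h2 0) 0
  rw [h3, zero_mul, add_zero] at h1
  have h4 := congrArg Matrix.det h1
  rw [Matrix.det_mul, hdA, zero_mul, Matrix.det_one] at h4
  exact zero_ne_one h4

/-- The map `M(A, B) ↦ K(B̃ A, det A, det B)` from the projective line over the ring `M` of
`2 × 2` matrices to the projective space `PG(5, K)`; see `hotje_eq`
for the independence of the chosen generator. -/
noncomputable def hotje (p : ProjLine (Matrix (Fin 2) (Fin 2) K)) : ℙ K (Fin 6 → K) :=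
  Projectivization.mk K _ (hotjeVec_ne_zero p.2.choose)

theorem hotjeVec_mul (U A B : Matrix (Fin 2) (Fin 2) K) :
    hotjeVec (U * A) (U * B) = U.det • hotjeVec A B := by
  have h : (U * B).adjugate * (U * A) = U.det • (B.adjugate * A) := by
    rw [Matrix.adjugate_mul_distrib, mul_assoc, ← mul_assoc U.adjugate, Matrix.adjugate_mul]
    simp
  ext i
  fin_cases i <;> simp [hotjeVec, h]

theorem hotje_eq (p : ProjLine (Matrix (Fin 2) (Fin 2) K))
    (g : GL (Fin 2) (Matrix (Fin 2) (Fin 2) K))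
    (hg : p.1 = Submodule.span (Matrix (Fin 2) (Fin 2) K) {g.1 0}) :
    hotje p = Projectivization.mk K _ (hotjeVec_ne_zero g) := by
  have hc := p.2.choose_spec
  have hmem : p.2.choose.1 0 ∈ Submodule.span (Matrix (Fin 2) (Fin 2) K) {g.1 0} := by
    exact (hc.symm.trans hg).le (Submodule.mem_span_singleton_self _)
  obtain ⟨U, hU⟩ := Submodule.mem_span_singleton.1 hmem
  refine (Projectivization.mk_eq_mk_iff' K _ _ _ _).2 ⟨U.det, ?_⟩
  rw [← hotjeVec_mul, ← hU]
  rfl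

variable (σ : K →+* K)

/-- The base block `ℙ(K) ⊆ ℙ(R)`, `R = K(ε; σ)`. -/
def baseBlock : Set (ProjLine (TwistedDual σ)) :=
  Set.range (ProjLine.map (TwistedDual.ofField σ))

/-- The blocks: the images of the base block under `GL₂(R)`. -/
def blocks : Set (Set (ProjLine (TwistedDual σ))) :=
  Set.range fun g : GL (Fin 2) (TwistedDual σ) => (fun p => p.act g) '' baseBlock σ

/-- The intersection of all blocks through three given points. -/
def trace (p₁ p₂ p₃ : ProjLine (TwistedDual σ)) : Set (ProjLine (TwistedDual σ)) :=
  ⋂₀ {B | B ∈ blocks σ ∧ p₁ ∈ B ∧ p₂ ∈ B ∧ p₃ ∈ B}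

/-- The geometric model: the map that sends the points of `ℙ(R) ⊆ ℙ(M)` to points
of `PG(5, K)`. -/
noncomputable def Φ (p : ProjLine (TwistedDual σ)) : ℙ K (Fin 6 → K) :=
  hotje (p.map (TwistedDual.toMatrix σ))

variable (K) in
/-- The vertex `K(0,1,0,0,0,0)`. -/
def vertex : ℙ K (Fin 6 → K) :=
  Projectivization.mk K ![0, 1, 0, 0, 0, 0] (fun h => one_ne_zero (congrFun h 1))

/-- The cone over the base block: the union of all lines joining the vertex with a
point of the base block. -/
def cone : Set (ℙ K (Fin 6 → K)) :=
  ⋃ b ∈ baseBlock σ,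
    (((vertex K).submodule ⊔ (Φ σ b).submodule).projectivization : Set (ℙ K (Fin 6 → K)))

variable (K) in
/-- The hyperplane `x₃ = 0` of `PG(5, K)` (coordinates are numbered from `1` to `6`). -/
def hyperplane : Submodule K (Fin 6 → K) := LinearMap.ker (LinearMap.proj 2)

/-- `U` is a `3`-space (a subspace of vector space dimension `4`) of the hyperplane `x₃ = 0`
that is complementary to the vertex in that hyperplane. -/
def IsComplementarySolid (U : Submodule K (Fin 6 → K)) : Prop :=
  Module.finrank K U = 4 ∧ Disjoint U (vertex K).submodule ∧
    U ⊔ (vertex K).submodule = hyperplane K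

/-- The subspace spanned by the images of three points. -/
noncomputable def plane (p₁ p₂ p₃ : ProjLine (TwistedDual σ)) : Submodule K (Fin 6 → K) :=
  (Φ σ p₁).submodule ⊔ (Φ σ p₂).submodule ⊔ (Φ σ p₃).submodule

/-- The `3`-spaces through the span of `p₁, p₂, p₃` and through `x` that are complementary
to the vertex. -/
def solidsThrough (p₁ p₂ p₃ x : ProjLine (TwistedDual σ)) : Set (Submodule K (Fin 6 → K)) :=
  {U | IsComplementarySolid U ∧ plane σ p₁ p₂ p₃ ≤ U ∧ (Φ σ x).submodule ≤ U}

end Geometry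

end TwistedDD

open TwistedDD

/-!
A point `R(a, b)` of the projective line over `R = K(ε; σ)` has a reduction `w ∈ K²` modulo the
maximal ideal, which is non-zero, and two points are parallel precisely if their reductions are
proportional. In the model, the point becomes `w ⊗ w^σ ∈ K⁴` (`twist`) together with one more
coordinate `x₂` (`height`), so the images of the points of `ℙ(R)` are the points of the cone
other than the vertex (`mem_cone_iff`), and the parallel classes lie on the generators of the
cone.

Every block is the image of the base block under some `g = G₀ + G₁ε` in `GL₂(R)`. On this image
`x₂` is a bilinear expression in `w` and `w^σ` with coefficient matrix `N = G₀⁻¹G₁`, that is, a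
linear form in `w ⊗ w^σ`, and `1 + Nε` shows that all linear forms occur. Since the `3`-spaces
complementary to the vertex are the graphs of linear forms `f : K⁴ → K`
(`isComplementarySolid_iff`), the blocks are their sections with the cone (`mem_blocks_iff`).

For three pairwise non-parallel points the tensors `wᵢ ⊗ wᵢ^σ` are linearly independent
(`linearIndependent_twist`), so everything is a matter of extending a linear form from a
`3`-dimensional subspace `W` of `K⁴`. The graphs of all extensions intersect in the graph of
the given form, which is the plane of the three points (`mem_span_prod_iff`). A prescribed value
at `w ⊗ w^σ` singles out one extension if this tensor is not in `W`; if it is in `W`, either all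
`q` extensions or none of them have the prescribed value.
-/

namespace TwistedDD

open Matrix Projectivization

variable {K : Type*} [Field K] {σ : K →+* K}

/-! ### Generators of points of the projective line over the twisted dual numbers -/

namespace TwistedDual

variable (σ) in
/-- The reduction `K(ε; σ) → K`, `a + bε ↦ a`, modulo the maximal ideal. -/
def reHom : TwistedDual σ →+* K where
  toFun x := x.re
  map_one' := rfl
  map_zero' := rfl
  map_mul' _ _ := rfl
  map_add' _ _ := rfl

@[simp] theorem reHom_apply (x : TwistedDual σ) : reHom σ x = x.re := rfl
@[simp] theorem ofField_re (a : K) : (ofField σ a).re = a := rfl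
@[simp] theorem ofField_im (a : K) : (ofField σ a).im = 0 := rfl

end TwistedDual

open TwistedDual

/-- The reduction of a row vector over `K(ε; σ)` modulo the maximal ideal. -/
def reVec (u : Fin 2 → TwistedDual σ) : Fin 2 → K := fun i => (u i).re

@[simp] theorem reVec_apply (u : Fin 2 → TwistedDual σ) (i : Fin 2) : reVec u i = (u i).re := rfl

theorem reVec_ofField_comp (v : Fin 2 → K) : reVec (ofField σ ∘ v) = v := rfl

/-- The ring `K(ε; σ)` is local, so invertibility of matrices can be tested on reductions. -/
theorem isUnit_of_det_re_ne_zero (X : Matrix (Fin 2) (Fin 2) (TwistedDual σ))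
    (h : (X.map (reHom σ)).det ≠ 0) : IsUnit X := by
  set Y : Matrix (Fin 2) (Fin 2) K := X.map (reHom σ) with hY
  have hYu : IsUnit Y := (Matrix.isUnit_iff_isUnit_det Y).2 (isUnit_iff_ne_zero.2 h)
  have hYinv : IsUnit Y⁻¹ := by
    rw [Matrix.isUnit_nonsing_inv_iff]; exact hYu
  obtain ⟨u, hu⟩ := hYinv.map ((ofField σ).mapMatrix (m := Fin 2))
  rw [← Units.isUnit_mul_units X u]
  have hre : ∀ i j, ((X * u.1 - 1) i j).re = 0 := by
    intro i j
    have h1 : ((X * u.1 - 1).map (reHom σ)) = 0 := by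
      have : (reHom σ).mapMatrix (X * u.1 - 1) = 0 := by
        rw [map_sub, map_mul, map_one, hu]
        have h2 : (reHom σ).mapMatrix ((ofField σ).mapMatrix Y⁻¹) = Y⁻¹ := by
          ext i j; simp
        rw [h2]
        have h3 : (reHom σ).mapMatrix X = Y := rfl
        rw [h3, Matrix.mul_nonsing_inv _ (isUnit_iff_ne_zero.2 h), sub_self]
      exact this
    exact congrFun (congrFun h1 i) j
  -- The difference to the identity has entries in the ideal `Kε`, whose square is zero.
  have hnil : IsNilpotent (X * u.1 - 1) := by
    refine ⟨2, ?_⟩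
    rw [pow_two]
    ext i j
    · simp [Matrix.mul_apply, Fin.sum_univ_two, hre, -Matrix.sub_apply]
    · simp [Matrix.mul_apply, Fin.sum_univ_two, hre, -Matrix.sub_apply]
  simpa using hnil.isUnit_one_add

theorem exists_GL_rows (u w : Fin 2 → TwistedDual σ)
    (h : (u 0).re * (w 1).re - (u 1).re * (w 0).re ≠ 0) :
    ∃ g : GL (Fin 2) (TwistedDual σ), g.1 0 = u ∧ g.1 1 = w := by
  obtain ⟨g, hg⟩ := isUnit_of_det_re_ne_zero (Matrix.of ![u, w])
    (by simpa [Matrix.det_fin_two] using h)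
  exact ⟨g, by rw [hg]; rfl, by rw [hg]; rfl⟩

theorem det_re_ne_zero (g : GL (Fin 2) (TwistedDual σ)) :
    (g.1 0 0).re * (g.1 1 1).re - (g.1 0 1).re * (g.1 1 0).re ≠ 0 := by
  have h := g.isUnit.map ((reHom σ).mapMatrix (m := Fin 2))
  rw [Matrix.isUnit_iff_isUnit_det, isUnit_iff_ne_zero, Matrix.det_fin_two] at h
  simpa using h

theorem exists_GL_row {u : Fin 2 → TwistedDual σ} (hu : reVec u ≠ 0) :
    ∃ g : GL (Fin 2) (TwistedDual σ), g.1 0 = u := by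
  by_cases h0 : (u 0).re = 0
  · have h1 : (u 1).re ≠ 0 := fun h1 => hu (by ext i; fin_cases i <;> simpa)
    obtain ⟨g, hg, -⟩ := exists_GL_rows u ![1, 0] (by simpa using h1)
    exact ⟨g, hg⟩
  · obtain ⟨g, hg, -⟩ := exists_GL_rows u ![0, 1] (by simpa using h0)
    exact ⟨g, hg⟩

theorem reVec_GL_row_ne_zero (g : GL (Fin 2) (TwistedDual σ)) : reVec (g.1 0) ≠ 0 := by
  intro h
  have h0 : (g.1 0 0).re = 0 := congrFun h 0
  have h1 : (g.1 0 1).re = 0 := congrFun h 1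
  exact det_re_ne_zero g (by rw [h0, h1]; ring)

/-- The point `R(a, b)` of the projective line over `R = K(ε; σ)`. Since `R` is local, the
admissible pairs `(a, b)` are those with non-zero reduction. -/
def ofVec (u : Fin 2 → TwistedDual σ) (hu : reVec u ≠ 0) : ProjLine (TwistedDual σ) :=
  ⟨Submodule.span _ {u}, by
    obtain ⟨g, rfl⟩ := exists_GL_row hu
    exact ⟨g, rfl⟩⟩

theorem exists_eq_ofVec (p : ProjLine (TwistedDual σ)) : ∃ u hu, p = ofVec u hu := by
  obtain ⟨g, hg⟩ := p.2
  exact ⟨g.1 0, reVec_GL_row_ne_zero g, Subtype.ext hg⟩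

theorem parallel_ofVec_iff {u w : Fin 2 → TwistedDual σ} (hu : reVec u ≠ 0) (hw : reVec w ≠ 0) :
    (ofVec u hu).Parallel (ofVec w hw) ↔ (u 0).re * (w 1).re - (u 1).re * (w 0).re = 0 := by
  rw [ProjLine.Parallel, not_iff_comm]
  constructor
  · intro h
    obtain ⟨g, h0, h1⟩ := exists_GL_rows u w h
    exact ⟨g, by rw [h0]; rfl, by rw [h1]; rfl⟩
  · rintro ⟨g, h0, h1⟩
    have hu' : u ∈ Submodule.span (TwistedDual σ) {g.1 0} :=
      h0 ▸ Submodule.mem_span_singleton_self u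
    have hw' : w ∈ Submodule.span (TwistedDual σ) {g.1 1} :=
      h1 ▸ Submodule.mem_span_singleton_self w
    obtain ⟨c, rfl⟩ := Submodule.mem_span_singleton.1 hu'
    obtain ⟨d, rfl⟩ := Submodule.mem_span_singleton.1 hw'
    have hc : c.re ≠ 0 := fun hc => hu (by ext i; simp [hc])
    have hd : d.re ≠ 0 := fun hd => hw (by ext i; simp [hd])
    have := mul_ne_zero (mul_ne_zero hc hd) (det_re_ne_zero g)
    intro h
    apply this
    rw [← h]
    simp only [Pi.smul_apply, smul_eq_mul, mul_re]
    ring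

theorem reVec_vecMul_ne_zero {u : Fin 2 → TwistedDual σ} (hu : reVec u ≠ 0)
    (g : GL (Fin 2) (TwistedDual σ)) : reVec (u ᵥ* g.1) ≠ 0 := by
  obtain ⟨h, rfl⟩ := exists_GL_row hu
  exact reVec_GL_row_ne_zero (h * g)

theorem act_ofVec {u : Fin 2 → TwistedDual σ} (hu : reVec u ≠ 0)
    (g : GL (Fin 2) (TwistedDual σ)) :
    (ofVec u hu).act g = ofVec (u ᵥ* g.1) (reVec_vecMul_ne_zero hu g) := by
  apply Subtype.ext
  change Submodule.map _ _ = _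
  change Submodule.map _ (Submodule.span _ {u}) = _
  rw [Submodule.map_span, Set.image_singleton]
  rfl

theorem mem_baseBlock_iff (p : ProjLine (TwistedDual σ)) :
    p ∈ baseBlock σ ↔ ∃ (v : Fin 2 → K) (hv : reVec (ofField σ ∘ v) ≠ 0),
      p = ofVec (ofField σ ∘ v) hv := by
  constructor
  · rintro ⟨r, rfl⟩
    obtain ⟨g, hg⟩ := r.2
    refine ⟨g.1 0, fun h : g.1 0 = 0 => ?_, Subtype.ext ?_⟩
    · have hd : g.1.det ≠ 0 := (Matrix.isUnit_iff_isUnit_det g.1).1 g.isUnit |>.ne_zero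
      apply hd
      rw [Matrix.det_fin_two, h]
      simp
    · change Submodule.span _ _ = Submodule.span _ _
      rw [hg, ProjLine.span_image_span]
  · rintro ⟨v, (hv : v ≠ 0), rfl⟩
    obtain ⟨g, hg⟩ : ∃ g : GL (Fin 2) K, g.1 0 = v := by
      by_cases h0 : v 0 = 0
      · have h1 : v 1 ≠ 0 := fun h1 => hv (by ext i; fin_cases i <;> simpa)
        exact ⟨Matrix.GeneralLinearGroup.mkOfDetNeZero (Matrix.of ![v, ![1, 0]])
          (by simpa [Matrix.det_fin_two] using h1), rfl⟩
      · exact ⟨Matrix.GeneralLinearGroup.mkOfDetNeZero (Matrix.of ![v, ![0, 1]])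
          (by simpa [Matrix.det_fin_two] using h0), rfl⟩
    refine ⟨⟨Submodule.span K {v}, g, by rw [hg]⟩, Subtype.ext ?_⟩
    exact ProjLine.span_image_span _ _

/-! ### The image of the projective line and the cone -/

variable (σ) in
/-- The coordinates of `w ⊗ w^σ`, in the order in which they occur in `PG(5, K)`. -/
def twist (w : Fin 2 → K) : Fin 4 → K :=
  ![w 0 * σ (w 1), w 1 * σ (w 0), w 0 * σ (w 0), w 1 * σ (w 1)]

/-- The coordinate `x₂` of the vector of `PG(5, K)` that represents the point `R(a, b)`. -/
def height (u : Fin 2 → TwistedDual σ) : K := (u 0).im * σ (u 1).re - (u 1).im * σ (u 0).re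

/-- The parametrization of the hyperplane `x₃ = 0` by the coordinates `x₁, x₄, x₅, x₆`, which
give the projection from the vertex, and the coordinate `x₂`. -/
def join : ((Fin 4 → K) × K) →ₗ[K] (Fin 6 → K) where
  toFun x := ![x.1 0, x.2, 0, x.1 1, x.1 2, x.1 3]
  map_add' x y := by ext i; fin_cases i <;> simp
  map_smul' c x := by ext i; fin_cases i <;> simp

theorem join_apply (x : (Fin 4 → K) × K) :
    join x = ![x.1 0, x.2, 0, x.1 1, x.1 2, x.1 3] := rfl

theorem join_injective : Function.Injective (join (K := K)) := by
  rintro ⟨a, s⟩ ⟨b, t⟩ h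
  rw [join_apply, join_apply] at h
  refine Prod.ext (funext fun i => ?_) (congrFun h 1)
  fin_cases i
  · exact congrFun h 0
  · exact congrFun h 3
  · exact congrFun h 4
  · exact congrFun h 5

theorem range_join : LinearMap.range (join (K := K)) = hyperplane K := by
  ext y
  constructor
  · rintro ⟨x, rfl⟩
    exact LinearMap.mem_ker.2 rfl
  · intro hy
    have hy2 : y 2 = 0 := LinearMap.mem_ker.1 hy
    refine ⟨(![y 0, y 3, y 4, y 5], y 1), ?_⟩
    rw [join_apply]
    ext i
    fin_cases i <;> simp [hy2]

theorem vertex_submodule : (vertex K).submodule = Submodule.span K {join (0, 1)} := by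
  rw [vertex, submodule_mk]
  congr 2

theorem hotjeVec_toMatrix (a b : TwistedDual σ) :
    hotjeVec (toMatrix σ a) (toMatrix σ b) =
      join (twist σ (reVec ![a, b]), height ![a, b]) := by
  ext i
  fin_cases i <;>
    simp [hotjeVec, toMatrix, join_apply, twist, height, Matrix.adjugate_fin_two,
      Matrix.mul_apply, Fin.sum_univ_two, Matrix.det_fin_two] <;> ring

theorem submodule_Φ_ofVec {u : Fin 2 → TwistedDual σ} (hu : reVec u ≠ 0) :
    (Φ σ (ofVec u hu)).submodule = Submodule.span K {join (twist σ (reVec u), height u)} := by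
  obtain ⟨g, rfl⟩ := exists_GL_row hu
  rw [Φ, hotje_eq _ (Units.map ((toMatrix σ).mapMatrix (m := Fin 2)).toMonoidHom g)
    (ProjLine.span_image_span _ _), submodule_mk]
  congr 2
  refine (hotjeVec_toMatrix (g.1 0 0) (g.1 0 1)).trans ?_
  have : ![g.1 0 0, g.1 0 1] = g.1 0 := by ext i <;> fin_cases i <;> rfl
  rw [this]

theorem twist_smul (c : K) (w : Fin 2 → K) : twist σ (c • w) = (c * σ c) • twist σ w := by
  ext i
  fin_cases i <;> simp [twist] <;> ring

theorem exists_reVec_height {w : Fin 2 → K} (hw : w ≠ 0) (s : K) :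
    ∃ u : Fin 2 → TwistedDual σ, reVec u = w ∧ height u = s := by
  by_cases h0 : w 0 = 0
  · have h1 : w 1 ≠ 0 := fun h1 => hw (by ext i; fin_cases i <;> simpa)
    refine ⟨![⟨w 0, s / σ (w 1)⟩, ⟨w 1, 0⟩], by ext i; fin_cases i <;> rfl, ?_⟩
    have : σ (w 1) ≠ 0 := (map_ne_zero σ).2 h1
    simp [height, this]
  · refine ⟨![⟨w 0, 0⟩, ⟨w 1, -s / σ (w 0)⟩], by ext i; fin_cases i <;> rfl, ?_⟩
    have : σ (w 0) ≠ 0 := (map_ne_zero σ).2 h0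
    simp [height]
    field_simp

/-- The generators `u` and `(1 + tε) u` have the same reduction and the same height, and any two
generators with this property are related in this way for a suitable `t`. -/
theorem ofVec_eq_ofVec {u w : Fin 2 → TwistedDual σ} (hu : reVec u ≠ 0) (hw : reVec w ≠ 0)
    (hre : reVec u = reVec w) (hh : height u = height w) : ofVec u hu = ofVec w hw := by
  have h0 : (u 0).re = (w 0).re := congrFun hre 0
  have h1 : (u 1).re = (w 1).re := congrFun hre 1
  rw [height, height, h0, h1] at hh
  obtain ⟨t, ht0, ht1⟩ : ∃ t, (w 0).im - (u 0).im = t * σ (w 0).re ∧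
      (w 1).im - (u 1).im = t * σ (w 1).re := by
    by_cases hz : (w 0).re = 0
    · have hz1 : σ (w 1).re ≠ 0 := (map_ne_zero σ).2 fun h => hw (by ext i; fin_cases i <;> simpa)
      refine ⟨((w 1).im - (u 1).im) / σ (w 1).re, ?_, by field_simp⟩
      rw [hz] at hh ⊢
      simp only [map_zero, mul_zero, sub_zero] at hh ⊢
      rw [mul_right_cancel₀ hz1 hh, sub_self]
    · have hz0 : σ (w 0).re ≠ 0 := (map_ne_zero σ).2 hz
      refine ⟨((w 0).im - (u 0).im) / σ (w 0).re, by field_simp, ?_⟩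
      field_simp
      linear_combination hh
  have hsmul : ∀ i, (⟨1, t⟩ : TwistedDual σ) * u i = w i ∧
      (⟨1, -t⟩ : TwistedDual σ) * w i = u i := by
    intro i
    fin_cases i <;> constructor <;> ext <;> simp [h0, h1] <;>
      first | linear_combination ht0 | linear_combination -ht0 | linear_combination ht1 |
        linear_combination -ht1
  apply Subtype.ext
  apply le_antisymm
  · exact (Submodule.span_singleton_le_iff_mem _ _).2
      (Submodule.mem_span_singleton.2 ⟨⟨1, -t⟩, funext fun i => (hsmul i).2⟩)
  · exact (Submodule.span_singleton_le_iff_mem _ _).2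
      (Submodule.mem_span_singleton.2 ⟨⟨1, t⟩, funext fun i => (hsmul i).1⟩)

theorem mem_cone_iff (y : ℙ K (Fin 6 → K)) : y ∈ cone σ ↔ y = vertex K ∨ ∃ p, Φ σ p = y := by
  simp only [cone, Set.mem_iUnion, SetLike.mem_coe, exists_prop,
    Submodule.mem_projectivization_iff_submodule_le]
  constructor
  · rintro ⟨b, hb, hy⟩
    obtain ⟨v, hv, rfl⟩ := (mem_baseBlock_iff b).1 hb
    rw [vertex_submodule, submodule_Φ_ofVec, y.submodule_eq,
      Submodule.span_singleton_le_iff_mem, Submodule.mem_sup] at hy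
    obtain ⟨_, h1, _, h2, hy⟩ := hy
    obtain ⟨s, rfl⟩ := Submodule.mem_span_singleton.1 h1
    obtain ⟨t, rfl⟩ := Submodule.mem_span_singleton.1 h2
    have hh : height (ofField σ ∘ v) = 0 := by simp [height]
    rw [hh, reVec_ofField_comp, ← map_smul, ← map_smul, ← map_add] at hy
    by_cases ht : t = 0
    · left
      apply submodule_injective
      have hs : s ≠ 0 := by
        rintro rfl
        exact y.rep_nonzero (by rw [← hy, ht]; simp)
      rw [vertex_submodule, y.submodule_eq, ← hy, ht, zero_smul, add_zero, map_smul]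
      exact Submodule.span_singleton_smul_eq (isUnit_iff_ne_zero.2 hs) _
    · right
      obtain ⟨u, hu, hus⟩ := exists_reVec_height (σ := σ) (w := v) hv (s / t)
      refine ⟨ofVec u (hu ▸ hv), submodule_injective ?_⟩
      rw [submodule_Φ_ofVec, y.submodule_eq, ← hy, hu, hus]
      have : (s • ((0 : Fin 4 → K), (1 : K)) + t • (twist σ v, (0 : K))) =
          t • (twist σ v, s / t) := by
        ext
        · simp
        · simp; field_simp
      rw [this, map_smul, Submodule.span_singleton_smul_eq (isUnit_iff_ne_zero.2 ht)]
  · rintro (rfl | ⟨p, rfl⟩)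
    · have h1 : (![1, 0] : Fin 2 → K) ≠ 0 := fun h => one_ne_zero (congrFun h 0)
      exact ⟨_, (mem_baseBlock_iff _).2 ⟨![1, 0], by rwa [reVec_ofField_comp], rfl⟩, le_sup_left⟩
    · obtain ⟨u, hu, rfl⟩ := exists_eq_ofVec p
      refine ⟨_, (mem_baseBlock_iff _).2 ⟨reVec u, by rwa [reVec_ofField_comp], rfl⟩, ?_⟩
      rw [vertex_submodule, submodule_Φ_ofVec, submodule_Φ_ofVec,
        Submodule.span_singleton_le_iff_mem]
      have hh : height (ofField σ ∘ reVec u) = 0 := by simp [height]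
      have : (twist σ (reVec u), height u) =
          height u • ((0 : Fin 4 → K), (1 : K)) + (twist σ (reVec u), (0 : K)) := by
        ext <;> simp
      rw [hh, reVec_ofField_comp, this, map_add, map_smul]
      exact Submodule.add_mem_sup (Submodule.smul_mem _ _ (Submodule.mem_span_singleton_self _))
        (Submodule.mem_span_singleton_self _)

theorem cone_inter_projectivization {U : Submodule K (Fin 6 → K)}
    (hU : ¬ (vertex K).submodule ≤ U) :
    cone σ ∩ (U.projectivization : Set (ℙ K (Fin 6 → K))) =
      Φ σ '' {p | (Φ σ p).submodule ≤ U} := by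
  ext y
  simp only [Set.mem_inter_iff, SetLike.mem_coe, mem_cone_iff,
    Submodule.mem_projectivization_iff_submodule_le]
  constructor
  · rintro ⟨rfl | ⟨p, rfl⟩, h⟩
    · exact absurd h hU
    · exact ⟨p, h, rfl⟩
  · rintro ⟨p, hp, rfl⟩
    exact ⟨Or.inr ⟨p, rfl⟩, hp⟩

/-! ### Solids complementary to the vertex -/

/-- The `3`-space of the hyperplane `x₃ = 0` with equation `x₂ = f(x₁, x₄, x₅, x₆)`. -/
def solid (f : (Fin 4 → K) →ₗ[K] K) : Submodule K (Fin 6 → K) := f.graph.map join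

theorem join_mem_solid_iff {f : (Fin 4 → K) →ₗ[K] K} {a : Fin 4 → K} {s : K} :
    join (a, s) ∈ solid f ↔ f a = s := by
  rw [solid, Submodule.mem_map]
  constructor
  · rintro ⟨x, hx, h⟩
    obtain rfl := join_injective h
    exact hx.symm
  · rintro rfl
    exact ⟨_, rfl, rfl⟩

theorem submodule_Φ_le_solid_iff {u : Fin 2 → TwistedDual σ} (hu : reVec u ≠ 0)
    {f : (Fin 4 → K) →ₗ[K] K} :
    (Φ σ (ofVec u hu)).submodule ≤ solid f ↔ f (twist σ (reVec u)) = height u := by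
  rw [submodule_Φ_ofVec, Submodule.span_singleton_le_iff_mem, join_mem_solid_iff]

theorem solid_injective : Function.Injective (solid (K := K)) := by
  intro f f' h
  ext1 a
  ext1
  exact (join_mem_solid_iff.1 (h ▸ join_mem_solid_iff.2 rfl)).symm

theorem disjoint_solid_vertex (f : (Fin 4 → K) →ₗ[K] K) :
    Disjoint (solid f) (vertex K).submodule := by
  rw [vertex_submodule, Submodule.disjoint_def]
  intro y hy hv
  obtain ⟨c, rfl⟩ := Submodule.mem_span_singleton.1 hv
  rw [← map_smul, Prod.smul_mk, smul_zero, join_mem_solid_iff, map_zero] at hy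
  rw [← map_smul, Prod.smul_mk, ← hy, smul_zero]
  exact map_zero _

theorem isComplementarySolid_solid (f : (Fin 4 → K) →ₗ[K] K) : IsComplementarySolid (solid f) := by
  refine ⟨?_, disjoint_solid_vertex f, ?_⟩
  · rw [solid, LinearMap.graph_eq_range_prod, ← LinearMap.range_comp,
      LinearMap.finrank_range_of_inj]
    · simp
    · exact join_injective.comp fun a b h => congrArg Prod.fst h
  · rw [← range_join, vertex_submodule]
    apply le_antisymm
    · refine sup_le ?_ ((Submodule.span_singleton_le_iff_mem _ _).2 ⟨_, rfl⟩)
      exact LinearMap.map_le_range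
    · rintro _ ⟨⟨a, s⟩, rfl⟩
      have : (a, s) = (a, f a) + (s - f a) • ((0 : Fin 4 → K), (1 : K)) := by
        ext <;> simp
      rw [this, map_add, map_smul]
      exact Submodule.add_mem_sup (join_mem_solid_iff.2 rfl)
        (Submodule.smul_mem _ _ (Submodule.mem_span_singleton_self _))

theorem isComplementarySolid_iff (U : Submodule K (Fin 6 → K)) :
    IsComplementarySolid U ↔ ∃ f, solid f = U := by
  refine ⟨?_, by rintro ⟨f, rfl⟩; exact isComplementarySolid_solid f⟩
  rintro ⟨-, hd, hs⟩
  rw [vertex_submodule] at hd hs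
  rw [Submodule.disjoint_def] at hd
  obtain ⟨f, hf⟩ := Submodule.exists_eq_graph (G := U.comap join) (by
    constructor
    · rintro ⟨⟨a, s⟩, hx⟩ ⟨⟨b, t⟩, hy⟩ (rfl : a = b)
      have hmem : join ((0 : Fin 4 → K), s - t) ∈ U := by
        have := U.sub_mem hx hy
        rwa [← map_sub, Prod.mk_sub_mk, sub_self] at this
      have h0 := hd _ hmem (Submodule.mem_span_singleton.2 ⟨s - t, by
        rw [← map_smul, Prod.smul_mk, smul_zero, smul_eq_mul, mul_one]⟩)
      have h1 := congrArg Prod.snd (join_injective (h0.trans (map_zero join).symm))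
      obtain rfl : s = t := sub_eq_zero.1 h1
      rfl
    · intro a
      have ha : join (a, 0) ∈ U ⊔ Submodule.span K {join ((0 : Fin 4 → K), (1 : K))} := by
        rw [hs, ← range_join]
        exact ⟨_, rfl⟩
      obtain ⟨u, hu, v, hv, huv⟩ := Submodule.mem_sup.1 ha
      obtain ⟨c, rfl⟩ := Submodule.mem_span_singleton.1 hv
      refine ⟨⟨(a, -c), ?_⟩, rfl⟩
      have : join (a, -c) = u := by
        rw [eq_sub_of_add_eq huv, ← map_smul, ← map_sub]
        simp
      rw [Submodule.mem_comap, this]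
      exact hu)
  refine ⟨f, ?_⟩
  rw [solid, ← hf, Submodule.map_comap_eq, inf_eq_right, range_join, ← hs]
  exact le_sup_left

theorem not_vertex_le_solid (f : (Fin 4 → K) →ₗ[K] K) : ¬ (vertex K).submodule ≤ solid f := by
  intro h
  rw [vertex_submodule, Submodule.span_singleton_le_iff_mem, join_mem_solid_iff, map_zero] at h
  exact zero_ne_one h

/-! ### Blocks as sections of the cone -/

/-- The linear form on `K⁴` that a matrix `N` defines on the tensors `w ⊗ w^σ`. Every linear form
arises in this way, see `exists_formOf_eq`. -/
def formOf (N : Matrix (Fin 2) (Fin 2) K) : (Fin 4 → K) →ₗ[K] K :=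
  N 0 0 • LinearMap.proj 0 + N 1 0 • LinearMap.proj 3 - N 0 1 • LinearMap.proj 2 -
    N 1 1 • LinearMap.proj 1

theorem formOf_twist (N : Matrix (Fin 2) (Fin 2) K) (w : Fin 2 → K) :
    formOf N (twist σ w) = (w ᵥ* N) 0 * σ (w 1) - (w ᵥ* N) 1 * σ (w 0) := by
  simp [formOf, twist, Matrix.vecMul, dotProduct, Fin.sum_univ_two]
  ring

theorem exists_formOf_eq (f : (Fin 4 → K) →ₗ[K] K) : ∃ N, formOf N = f := by
  refine ⟨!![f (Pi.single 0 1), -f (Pi.single 2 1); f (Pi.single 3 1), -f (Pi.single 1 1)], ?_⟩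
  refine LinearMap.pi_ext' fun i => LinearMap.ext_ring ?_
  fin_cases i <;> simp [formOf]

/-- The points of the base block, moved by `g = G₀ + G₁ε`, have heights that are given by the
linear form of `G₀⁻¹G₁`. -/
theorem height_vecMul (g : GL (Fin 2) (TwistedDual σ)) (v : Fin 2 → K) :
    height ((ofField σ ∘ v) ᵥ* g.1) =
      formOf ((g.1.map (reHom σ))⁻¹ * g.1.map TwistedDual.im)
        (twist σ (reVec ((ofField σ ∘ v) ᵥ* g.1))) := by
  have hre : reVec ((ofField σ ∘ v) ᵥ* g.1) = v ᵥ* g.1.map (reHom σ) := by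
    ext i
    simp [Matrix.vecMul, dotProduct, Fin.sum_univ_two]
  have him : ∀ i, (((ofField σ ∘ v) ᵥ* g.1) i).im = (v ᵥ* g.1.map TwistedDual.im) i := by
    intro i
    simp [Matrix.vecMul, dotProduct, Fin.sum_univ_two]
  have hdet : IsUnit (g.1.map (reHom σ)).det :=
    (Matrix.isUnit_iff_isUnit_det _).1 (g.isUnit.map ((reHom σ).mapMatrix (m := Fin 2)))
  rw [formOf_twist, hre, Matrix.vecMul_vecMul, ← mul_assoc, Matrix.mul_nonsing_inv _ hdet, one_mul,
    ← hre, height, him, him]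
  rfl

theorem image_act_baseBlock (g : GL (Fin 2) (TwistedDual σ)) :
    (fun p => p.act g) '' baseBlock σ = {p | (Φ σ p).submodule ≤
      solid (formOf ((g.1.map (reHom σ))⁻¹ * g.1.map TwistedDual.im))} := by
  ext p
  constructor
  · rintro ⟨q, hq, rfl⟩
    obtain ⟨v, hv, rfl⟩ := (mem_baseBlock_iff q).1 hq
    simp only [Set.mem_ofPred_eq, act_ofVec, submodule_Φ_le_solid_iff, height_vecMul]
  · intro hp
    obtain ⟨u, hu, rfl⟩ := exists_eq_ofVec p
    rw [Set.mem_ofPred_eq, submodule_Φ_le_solid_iff] at hp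
    have hdet : IsUnit (g.1.map (reHom σ)).det :=
      (Matrix.isUnit_iff_isUnit_det _).1 (g.isUnit.map ((reHom σ).mapMatrix (m := Fin 2)))
    set v : Fin 2 → K := reVec u ᵥ* (g.1.map (reHom σ))⁻¹ with hv
    have hvu : v ᵥ* g.1.map (reHom σ) = reVec u := by
      rw [hv, Matrix.vecMul_vecMul, Matrix.nonsing_inv_mul _ hdet, Matrix.vecMul_one]
    have hv0 : v ≠ 0 := by
      intro h
      rw [h, Matrix.zero_vecMul] at hvu
      exact hu hvu.symm
    have hre : reVec ((ofField σ ∘ v) ᵥ* g.1) = reVec u := by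
      rw [← hvu]
      ext i
      simp [Matrix.vecMul, dotProduct, Fin.sum_univ_two]
    refine ⟨_, (mem_baseBlock_iff _).2 ⟨v, by rwa [reVec_ofField_comp], rfl⟩, ?_⟩
    simp only [act_ofVec]
    exact ofVec_eq_ofVec _ _ hre (by rw [height_vecMul, hre, hp])

/-- The blocks are the sections of the cone with the `3`-spaces complementary to the vertex. -/
theorem mem_blocks_iff (B : Set (ProjLine (TwistedDual σ))) :
    B ∈ blocks σ ↔ ∃ f, B = {p | (Φ σ p).submodule ≤ solid f} := by
  constructor
  · rintro ⟨g, rfl⟩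
    exact ⟨_, image_act_baseBlock g⟩
  · rintro ⟨f, rfl⟩
    obtain ⟨N, rfl⟩ := exists_formOf_eq f
    -- The matrix `1 + Nε`.
    set X : Matrix (Fin 2) (Fin 2) (TwistedDual σ) :=
      Matrix.of fun i j => ⟨(1 : Matrix (Fin 2) (Fin 2) K) i j, N i j⟩ with hX
    have hre : X.map (reHom σ) = 1 := rfl
    have him : X.map TwistedDual.im = N := rfl
    obtain ⟨g, hg⟩ := isUnit_of_det_re_ne_zero X (by simp [hre])
    refine ⟨g, ?_⟩
    have := image_act_baseBlock g
    rw [hg, hre, him, inv_one, one_mul] at this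
    exact this

/-! ### Linear forms with prescribed values -/

section Interpolation

variable {a : Fin 3 → Fin 4 → K}

theorem existsUnique_linearMap_of_notMem_span (ha : LinearIndependent K a) (s : Fin 3 → K)
    {b : Fin 4 → K} (hb : b ∉ Submodule.span K (Set.range a)) (t : K) :
    ∃! f : (Fin 4 → K) →ₗ[K] K, (∀ i, f (a i) = s i) ∧ f b = t := by
  have hli : LinearIndependent K (Fin.snoc a b : Fin 4 → Fin 4 → K) :=
    linearIndependent_finSnoc.2 ⟨ha, hb⟩
  set B := basisOfLinearIndependentOfCardEqFinrank hli (by simp) with hB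
  have hBi : ∀ i, B i = (Fin.snoc a b : Fin 4 → Fin 4 → K) i := fun i => by
    rw [hB, coe_basisOfLinearIndependentOfCardEqFinrank]
  have key : ∀ f : (Fin 4 → K) →ₗ[K] K, ((∀ i, f (a i) = s i) ∧ f b = t) ↔
      ∀ i, f (B i) = (Fin.snoc s t : Fin 4 → K) i := by
    intro f
    rw [Fin.forall_fin_succ' (P := fun i => f (B i) = (Fin.snoc s t : Fin 4 → K) i)]
    simp only [hBi, Fin.snoc_castSucc, Fin.snoc_last]
  refine ⟨B.constr K (Fin.snoc s t : Fin 4 → K), ?_, ?_⟩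
  · simp only [key]
    intro i
    rw [B.constr_basis]
  · intro f hf
    refine B.ext fun i => ?_
    rw [(key f).1 hf i, B.constr_basis]

theorem exists_notMem_span (a : Fin 3 → Fin 4 → K) : ∃ b, b ∉ Submodule.span K (Set.range a) := by
  by_contra! h
  have htop : Submodule.span K (Set.range a) = ⊤ := eq_top_iff.2 fun b _ => h b
  have h1 := finrank_range_le_card (R := K) a
  rw [Set.finrank, htop, finrank_top] at h1
  simp at h1

theorem ncard_linearMap (ha : LinearIndependent K a) (s : Fin 3 → K) :
    {f : (Fin 4 → K) →ₗ[K] K | ∀ i, f (a i) = s i}.ncard = Nat.card K := by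
  obtain ⟨b, hb⟩ := exists_notMem_span a
  rw [← Nat.card_coe_set_eq]
  refine Nat.card_eq_of_bijective
    (fun f : {f : (Fin 4 → K) →ₗ[K] K | ∀ i, f (a i) = s i} => f.1 b) ⟨?_, ?_⟩
  · intro f f' h
    exact Subtype.ext ((existsUnique_linearMap_of_notMem_span ha s hb (f'.1 b)).unique
      ⟨f.2, h⟩ ⟨f'.2, rfl⟩)
  · intro t
    obtain ⟨f, ⟨hf, rfl⟩, -⟩ := existsUnique_linearMap_of_notMem_span ha s hb t
    exact ⟨⟨f, hf⟩, rfl⟩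

/-- A subspace that is the graph of a linear form on a subspace is the intersection of the graphs
of the extensions of this form. -/
theorem mem_span_prod_iff (ha : LinearIndependent K a) (s : Fin 3 → K) (b : Fin 4 → K) (t : K) :
    (b, t) ∈ Submodule.span K (Set.range fun i => (a i, s i)) ↔
      ∀ f : (Fin 4 → K) →ₗ[K] K, (∀ i, f (a i) = s i) → f b = t := by
  constructor
  · intro h f hf
    have hle : Submodule.span K (Set.range fun i => (a i, s i)) ≤ f.graph := by
      rw [Submodule.span_le]
      rintro _ ⟨i, rfl⟩
      exact (hf i).symm
    exact (hle h).symm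
  · intro h
    by_cases hb : b ∈ Submodule.span K (Set.range a)
    · obtain ⟨b', hb'⟩ := exists_notMem_span a
      obtain ⟨f, ⟨hf, -⟩, -⟩ := existsUnique_linearMap_of_notMem_span ha s hb' 0
      obtain ⟨c, rfl⟩ := (Submodule.mem_span_range_iff_exists_fun K).1 hb
      refine (Submodule.mem_span_range_iff_exists_fun K).2 ⟨c, ?_⟩
      rw [← h f hf]
      ext <;> simp [Prod.fst_sum, Prod.snd_sum, map_sum, hf]
    · obtain ⟨f, ⟨hf, hfb⟩, -⟩ := existsUnique_linearMap_of_notMem_span ha s hb (t + 1)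
      have := h f hf
      rw [hfb] at this
      exact absurd (by linear_combination this) (one_ne_zero (α := K))

end Interpolation

/-! ### The plane of three points -/

/-- Contracting a tensor `w ⊗ w^σ` with linear forms that vanish on `wᵢ` and on `wⱼ^σ`
respectively kills the tensors of `wᵢ` and `wⱼ`. -/
theorem linearIndependent_twist {w : Fin 3 → Fin 2 → K}
    (h01 : w 0 0 * w 1 1 - w 0 1 * w 1 0 ≠ 0) (h02 : w 0 0 * w 2 1 - w 0 1 * w 2 0 ≠ 0)
    (h12 : w 1 0 * w 2 1 - w 1 1 * w 2 0 ≠ 0) :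
    LinearIndependent K fun i => twist σ (w i) := by
  rw [Fintype.linearIndependent_iff]
  intro c hc
  rw [Fin.sum_univ_three] at hc
  have e0 : c 0 * (w 0 0 * σ (w 0 1)) + c 1 * (w 1 0 * σ (w 1 1)) + c 2 * (w 2 0 * σ (w 2 1)) = 0 :=
    congrFun hc 0
  have e1 : c 0 * (w 0 1 * σ (w 0 0)) + c 1 * (w 1 1 * σ (w 1 0)) + c 2 * (w 2 1 * σ (w 2 0)) = 0 :=
    congrFun hc 1
  have e2 : c 0 * (w 0 0 * σ (w 0 0)) + c 1 * (w 1 0 * σ (w 1 0)) + c 2 * (w 2 0 * σ (w 2 0)) = 0 :=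
    congrFun hc 2
  have e3 : c 0 * (w 0 1 * σ (w 0 1)) + c 1 * (w 1 1 * σ (w 1 1)) + c 2 * (w 2 1 * σ (w 2 1)) = 0 :=
    congrFun hc 3
  have hσ : ∀ {x : K}, x ≠ 0 → σ x ≠ 0 := fun hx => (map_ne_zero σ).2 hx
  have contract : ∀ i j : Fin 3,
      c 0 * ((w i 0 * w 0 1 - w i 1 * w 0 0) * σ (w j 0 * w 0 1 - w j 1 * w 0 0)) +
      c 1 * ((w i 0 * w 1 1 - w i 1 * w 1 0) * σ (w j 0 * w 1 1 - w j 1 * w 1 0)) +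
      c 2 * ((w i 0 * w 2 1 - w i 1 * w 2 0) * σ (w j 0 * w 2 1 - w j 1 * w 2 0)) = 0 := by
    intro i j
    simp only [map_sub, map_mul]
    linear_combination w i 0 * σ (w j 0) * e3 - w i 0 * σ (w j 1) * e1 - w i 1 * σ (w j 0) * e0 +
      w i 1 * σ (w j 1) * e2
  have k0 := contract 1 2
  have k1 := contract 0 2
  have k2 := contract 0 1
  have self : ∀ i, w i 0 * w i 1 - w i 1 * w i 0 = 0 := fun i => by ring
  simp only [self, map_zero, mul_zero, zero_mul, add_zero, zero_add] at k0 k1 k2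
  have h10 : w 1 0 * w 0 1 - w 1 1 * w 0 0 ≠ 0 := fun h => h01 (by linear_combination -h)
  have h20 : w 2 0 * w 0 1 - w 2 1 * w 0 0 ≠ 0 := fun h => h02 (by linear_combination -h)
  have h21 : w 2 0 * w 1 1 - w 2 1 * w 1 0 ≠ 0 := fun h => h12 (by linear_combination -h)
  intro i
  fin_cases i
  · exact (mul_eq_zero.1 k0).resolve_right (mul_ne_zero h10 (hσ h20))
  · exact (mul_eq_zero.1 k1).resolve_right (mul_ne_zero h01 (hσ h21))
  · exact (mul_eq_zero.1 k2).resolve_right (mul_ne_zero h02 (hσ h12))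

section ThreePoints

variable {u : Fin 3 → Fin 2 → TwistedDual σ} (hu : ∀ i, reVec (u i) ≠ 0)

theorem plane_eq_map : plane σ (ofVec (u 0) (hu 0)) (ofVec (u 1) (hu 1)) (ofVec (u 2) (hu 2)) =
    (Submodule.span K (Set.range fun i => (twist σ (reVec (u i)), height (u i)))).map join := by
  rw [plane, submodule_Φ_ofVec, submodule_Φ_ofVec, submodule_Φ_ofVec, Submodule.map_span,
    ← Submodule.span_union, ← Submodule.span_union]
  congr 1
  ext y
  simp only [Set.mem_union, Set.mem_singleton_iff, ← Set.range_comp, Set.mem_range,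
    Fin.exists_fin_succ, Fin.succ_zero_eq_one, Fin.succ_one_eq_two, IsEmpty.exists_iff, or_false,
    or_assoc, Function.comp_apply]
  simp only [eq_comm]

theorem join_mem_plane_iff {a : Fin 4 → K} {s : K} :
    join (a, s) ∈ plane σ (ofVec (u 0) (hu 0)) (ofVec (u 1) (hu 1)) (ofVec (u 2) (hu 2)) ↔
      (a, s) ∈ Submodule.span K (Set.range fun i => (twist σ (reVec (u i)), height (u i))) := by
  rw [plane_eq_map]
  constructor
  · rintro ⟨x, hx, h⟩
    obtain rfl := join_injective h
    exact hx
  · exact fun h => ⟨_, h, rfl⟩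

theorem finrank_plane (hli : LinearIndependent K fun i => twist σ (reVec (u i))) :
    Module.finrank K
      (plane σ (ofVec (u 0) (hu 0)) (ofVec (u 1) (hu 1)) (ofVec (u 2) (hu 2))) = 3 := by
  have hli' : LinearIndependent K fun i => (twist σ (reVec (u i)), height (u i)) :=
    LinearIndependent.of_comp (LinearMap.fst K (Fin 4 → K) K) hli
  rw [plane_eq_map,
    (Submodule.equivMapOfInjective join join_injective _).symm.finrank_eq,
    finrank_span_eq_card hli', Fintype.card_fin]

theorem plane_le_solid_iff (f : (Fin 4 → K) →ₗ[K] K) :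
    plane σ (ofVec (u 0) (hu 0)) (ofVec (u 1) (hu 1)) (ofVec (u 2) (hu 2)) ≤ solid f ↔
      ∀ i, f (twist σ (reVec (u i))) = height (u i) := by
  rw [plane, sup_le_iff, sup_le_iff, submodule_Φ_le_solid_iff, submodule_Φ_le_solid_iff,
    submodule_Φ_le_solid_iff]
  simp [Fin.forall_fin_succ, and_assoc]

theorem mem_trace_iff (p : ProjLine (TwistedDual σ)) :
    p ∈ trace σ (ofVec (u 0) (hu 0)) (ofVec (u 1) (hu 1)) (ofVec (u 2) (hu 2)) ↔
      ∀ f : (Fin 4 → K) →ₗ[K] K, (∀ i, f (twist σ (reVec (u i))) = height (u i)) →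
        (Φ σ p).submodule ≤ solid f := by
  constructor
  · intro h f hf
    have hB : {p | (Φ σ p).submodule ≤ solid f} ∈ blocks σ := (mem_blocks_iff _).2 ⟨f, rfl⟩
    exact h _ ⟨hB, (submodule_Φ_le_solid_iff _).2 (hf 0), (submodule_Φ_le_solid_iff _).2 (hf 1),
      (submodule_Φ_le_solid_iff _).2 (hf 2)⟩
  · rintro h B ⟨hB, h0, h1, h2⟩
    obtain ⟨f, rfl⟩ := (mem_blocks_iff _).1 hB
    exact h f ((plane_le_solid_iff hu f).1 (sup_le (sup_le h0 h1) h2))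

theorem mem_trace_iff_le_plane (hli : LinearIndependent K fun i => twist σ (reVec (u i)))
    (p : ProjLine (TwistedDual σ)) :
    p ∈ trace σ (ofVec (u 0) (hu 0)) (ofVec (u 1) (hu 1)) (ofVec (u 2) (hu 2)) ↔
      (Φ σ p).submodule ≤
        plane σ (ofVec (u 0) (hu 0)) (ofVec (u 1) (hu 1)) (ofVec (u 2) (hu 2)) := by
  obtain ⟨v, hv, rfl⟩ := exists_eq_ofVec p
  rw [mem_trace_iff, submodule_Φ_ofVec, Submodule.span_singleton_le_iff_mem, join_mem_plane_iff,
    mem_span_prod_iff hli]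
  simp only [Submodule.span_singleton_le_iff_mem, join_mem_solid_iff]

theorem not_vertex_le_plane (hli : LinearIndependent K fun i => twist σ (reVec (u i))) :
    ¬ (vertex K).submodule ≤
      plane σ (ofVec (u 0) (hu 0)) (ofVec (u 1) (hu 1)) (ofVec (u 2) (hu 2)) := by
  obtain ⟨b, hb⟩ := exists_notMem_span fun i => twist σ (reVec (u i))
  obtain ⟨f, ⟨hf, -⟩, -⟩ :=
    existsUnique_linearMap_of_notMem_span hli (fun i => height (u i)) hb 0
  exact fun h => not_vertex_le_solid f (h.trans ((plane_le_solid_iff hu f).2 hf))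

theorem solidsThrough_eq_image {v : Fin 2 → TwistedDual σ} (hv : reVec v ≠ 0) :
    solidsThrough σ (ofVec (u 0) (hu 0)) (ofVec (u 1) (hu 1)) (ofVec (u 2) (hu 2)) (ofVec v hv) =
      solid '' {f | (∀ i, f (twist σ (reVec (u i))) = height (u i)) ∧
        f (twist σ (reVec v)) = height v} := by
  ext U
  constructor
  · rintro ⟨hU, hp, hx⟩
    obtain ⟨f, rfl⟩ := (isComplementarySolid_iff U).1 hU
    exact ⟨f, ⟨(plane_le_solid_iff hu f).1 hp, (submodule_Φ_le_solid_iff hv).1 hx⟩, rfl⟩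
  · rintro ⟨f, ⟨hp, hx⟩, rfl⟩
    exact ⟨isComplementarySolid_solid f, (plane_le_solid_iff hu f).2 hp,
      (submodule_Φ_le_solid_iff hv).2 hx⟩

/-- The blocks through four points correspond to the complementary solids through these points;
the vertex is in no such solid, so it does not occur in the sections. -/
theorem sections_eq (p₁ p₂ p₃ x : ProjLine (TwistedDual σ)) :
    {D | ∃ B ∈ blocks σ, p₁ ∈ B ∧ p₂ ∈ B ∧ p₃ ∈ B ∧ x ∈ B ∧ D = Φ σ '' B} =
      {D | ∃ U ∈ solidsThrough σ p₁ p₂ p₃ x,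
        D = cone σ ∩ (U.projectivization : Set (ℙ K (Fin 6 → K)))} := by
  ext D
  constructor
  · rintro ⟨B, hB, h1, h2, h3, hx, rfl⟩
    obtain ⟨f, rfl⟩ := (mem_blocks_iff B).1 hB
    exact ⟨solid f, ⟨isComplementarySolid_solid f, sup_le (sup_le h1 h2) h3, hx⟩,
      (cone_inter_projectivization (not_vertex_le_solid f)).symm⟩
  · rintro ⟨U, ⟨hU, hp, hx⟩, rfl⟩
    obtain ⟨f, rfl⟩ := (isComplementarySolid_iff U).1 hU
    refine ⟨_, (mem_blocks_iff _).2 ⟨f, rfl⟩, (le_sup_left.trans le_sup_left).trans hp,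
      (le_sup_right.trans le_sup_left).trans hp, le_sup_right.trans hp, hx,
      cone_inter_projectivization (not_vertex_le_solid f)⟩

/-- Parallel points lie on the same generator of the cone. -/
theorem exists_twist_eq_smul_of_parallel {v w : Fin 2 → TwistedDual σ} (hv : reVec v ≠ 0)
    (hw : reVec w ≠ 0) (h : (ofVec v hv).Parallel (ofVec w hw)) :
    ∃ c : K, twist σ (reVec v) = c • twist σ (reVec w) := by
  rw [parallel_ofVec_iff] at h
  obtain ⟨d, hd⟩ : ∃ d : K, reVec v = d • reVec w := by
    by_cases h0 : (w 0).re = 0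
    · have h1 : (w 1).re ≠ 0 := fun h1 => hw (by ext i; fin_cases i <;> simpa)
      refine ⟨(v 1).re / (w 1).re, ?_⟩
      have hv0 : (v 0).re = 0 := by
        rw [h0, mul_zero, sub_zero] at h
        exact (mul_eq_zero.1 h).resolve_right h1
      ext i
      fin_cases i <;> simp [h0, h1, hv0]
    · refine ⟨(v 0).re / (w 0).re, ?_⟩
      ext i
      fin_cases i
      · simp [h0]
      · simp only [Fin.mk_one, reVec_apply, Pi.smul_apply, smul_eq_mul]
        field_simp
        linear_combination -h
  exact ⟨_, hd ▸ twist_smul d _⟩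

/-- A generator of the cone carries a point of the trace if and only if its projection from the
vertex lies in the projection of the plane. -/
theorem twist_mem_span_iff (hli : LinearIndependent K fun i => twist σ (reVec (u i)))
    {v : Fin 2 → TwistedDual σ} (hv : reVec v ≠ 0) :
    twist σ (reVec v) ∈ Submodule.span K (Set.range fun i => twist σ (reVec (u i))) ↔
      ∃ x' ∈ trace σ (ofVec (u 0) (hu 0)) (ofVec (u 1) (hu 1)) (ofVec (u 2) (hu 2)),
        (ofVec v hv).Parallel x' := by
  have hmap : Submodule.span K (Set.range fun i => twist σ (reVec (u i))) =
      (Submodule.span K (Set.range fun i => (twist σ (reVec (u i)), height (u i)))).map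
        (LinearMap.fst K (Fin 4 → K) K) := by
    rw [Submodule.map_span, ← Set.range_comp]
    rfl
  constructor
  · intro h
    rw [hmap] at h
    obtain ⟨⟨a, s⟩, hs, (rfl : a = _)⟩ := h
    obtain ⟨w, hwv, rfl⟩ := exists_reVec_height (σ := σ) hv s
    have hw : reVec w ≠ 0 := hwv ▸ hv
    have h0 : (w 0).re = (v 0).re := congrFun hwv 0
    have h1 : (w 1).re = (v 1).re := congrFun hwv 1
    refine ⟨ofVec w hw, ?_, ?_⟩
    · rwa [mem_trace_iff_le_plane hu hli, submodule_Φ_ofVec, Submodule.span_singleton_le_iff_mem,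
        join_mem_plane_iff, hwv]
    · rw [parallel_ofVec_iff, h0, h1]
      ring
  · rintro ⟨x', hx', hpar⟩
    obtain ⟨w, hw, rfl⟩ := exists_eq_ofVec x'
    obtain ⟨c, hc⟩ := exists_twist_eq_smul_of_parallel hv hw hpar
    rw [mem_trace_iff_le_plane hu hli, submodule_Φ_ofVec, Submodule.span_singleton_le_iff_mem,
      join_mem_plane_iff] at hx'
    rw [hc, hmap]
    exact Submodule.smul_mem _ _ ⟨_, hx', rfl⟩

theorem image_trace_eq (hli : LinearIndependent K fun i => twist σ (reVec (u i))) :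
    Φ σ '' trace σ (ofVec (u 0) (hu 0)) (ofVec (u 1) (hu 1)) (ofVec (u 2) (hu 2)) =
      cone σ ∩ ((plane σ (ofVec (u 0) (hu 0)) (ofVec (u 1) (hu 1))
        (ofVec (u 2) (hu 2))).projectivization : Set (ℙ K (Fin 6 → K))) := by
  rw [cone_inter_projectivization (not_vertex_le_plane hu hli)]
  congr 1
  ext p
  exact mem_trace_iff_le_plane hu hli p

theorem ncard_solidsThrough_of_mem_trace
    (hli : LinearIndependent K fun i => twist σ (reVec (u i))) {x : ProjLine (TwistedDual σ)}
    (hx : x ∈ trace σ (ofVec (u 0) (hu 0)) (ofVec (u 1) (hu 1)) (ofVec (u 2) (hu 2))) :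
    (solidsThrough σ (ofVec (u 0) (hu 0)) (ofVec (u 1) (hu 1)) (ofVec (u 2) (hu 2)) x).ncard =
      Nat.card K := by
  obtain ⟨v, hv, rfl⟩ := exists_eq_ofVec x
  rw [solidsThrough_eq_image, Set.ncard_image_of_injective _ solid_injective,
    ← ncard_linearMap hli fun i => height (u i)]
  congr 1
  ext f
  exact ⟨fun h => h.1, fun h =>
    ⟨h, (submodule_Φ_le_solid_iff hv).1 ((mem_trace_iff hu _).1 hx f h)⟩⟩

theorem ncard_solidsThrough_of_parallel
    (hli : LinearIndependent K fun i => twist σ (reVec (u i))) {x : ProjLine (TwistedDual σ)}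
    (hx : x ∉ trace σ (ofVec (u 0) (hu 0)) (ofVec (u 1) (hu 1)) (ofVec (u 2) (hu 2)))
    (hpar : ∃ x' ∈ trace σ (ofVec (u 0) (hu 0)) (ofVec (u 1) (hu 1)) (ofVec (u 2) (hu 2)),
      x.Parallel x') :
    (solidsThrough σ (ofVec (u 0) (hu 0)) (ofVec (u 1) (hu 1)) (ofVec (u 2) (hu 2)) x).ncard =
      0 := by
  obtain ⟨v, hv, rfl⟩ := exists_eq_ofVec x
  rw [← twist_mem_span_iff hu hli hv] at hpar
  rw [solidsThrough_eq_image, Set.ncard_image_of_injective _ solid_injective]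
  rw [Set.eq_empty_of_forall_notMem (s := {f | _ ∧ _}) ?_, Set.ncard_empty]
  rintro f ⟨hf, hfv⟩
  -- The linear forms with the prescribed values agree on the span of the tensors `wᵢ ⊗ wᵢ^σ`.
  refine hx ((mem_trace_iff hu _).2 fun f' hf' => (submodule_Φ_le_solid_iff hv).2 ?_)
  rw [← hfv]
  refine LinearMap.eqOn_span (s := Set.range fun i => twist σ (reVec (u i))) ?_ hpar
  rintro _ ⟨i, rfl⟩
  exact (hf' i).trans (hf i).symm

theorem ncard_solidsThrough_of_not_parallel
    (hli : LinearIndependent K fun i => twist σ (reVec (u i))) {x : ProjLine (TwistedDual σ)}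
    (hpar : ¬ ∃ x' ∈ trace σ (ofVec (u 0) (hu 0)) (ofVec (u 1) (hu 1)) (ofVec (u 2) (hu 2)),
      x.Parallel x') :
    (solidsThrough σ (ofVec (u 0) (hu 0)) (ofVec (u 1) (hu 1)) (ofVec (u 2) (hu 2)) x).ncard =
      1 := by
  obtain ⟨v, hv, rfl⟩ := exists_eq_ofVec x
  rw [← twist_mem_span_iff hu hli hv] at hpar
  rw [solidsThrough_eq_image, Set.ncard_image_of_injective _ solid_injective, Set.ncard_eq_one]
  obtain ⟨f, hf, huniq⟩ :=
    existsUnique_linearMap_of_notMem_span hli (fun i => height (u i)) hpar (height v)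
  exact ⟨f, Set.eq_singleton_iff_unique_mem.2 ⟨hf, huniq⟩⟩

end ThreePoints

/-- Three points can be given by one family of generators, and the tensors of three pairwise
non-parallel points are linearly independent. -/
theorem exists_generators {p₁ p₂ p₃ : ProjLine (TwistedDual σ)}
    (h₁₂ : ¬ p₁.Parallel p₂) (h₁₃ : ¬ p₁.Parallel p₃) (h₂₃ : ¬ p₂.Parallel p₃) :
    ∃ (u : Fin 3 → Fin 2 → TwistedDual σ) (hu : ∀ i, reVec (u i) ≠ 0),
      (LinearIndependent K fun i => twist σ (reVec (u i))) ∧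
      p₁ = ofVec (u 0) (hu 0) ∧ p₂ = ofVec (u 1) (hu 1) ∧ p₃ = ofVec (u 2) (hu 2) := by
  obtain ⟨u₁, hu₁, rfl⟩ := exists_eq_ofVec p₁
  obtain ⟨u₂, hu₂, rfl⟩ := exists_eq_ofVec p₂
  obtain ⟨u₃, hu₃, rfl⟩ := exists_eq_ofVec p₃
  rw [parallel_ofVec_iff] at h₁₂ h₁₃ h₂₃
  exact ⟨![u₁, u₂, u₃], Fin.forall_fin_succ.2 ⟨hu₁, Fin.forall_fin_two.2 ⟨hu₂, hu₃⟩⟩,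
    linearIndependent_twist h₁₂ h₁₃ h₂₃, rfl, rfl, rfl⟩

end TwistedDD

theorem mainTheorem6 {K : Type*} [Field K] [Finite K] (σ : K →+* K) (hσ : σ ≠ RingHom.id K)
    (p₁ p₂ p₃ : ProjLine (TwistedDual σ))
    (h₁₂ : ¬ p₁.Parallel p₂) (h₁₃ : ¬ p₁.Parallel p₃) (h₂₃ : ¬ p₂.Parallel p₃) :
    (Module.finrank K (plane σ p₁ p₂ p₃) = 3 ∧
      Φ σ '' trace σ p₁ p₂ p₃ =
        cone σ ∩ ((plane σ p₁ p₂ p₃).projectivization : Set (ℙ K (Fin 6 → K)))) ∧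
    ∀ x : ProjLine (TwistedDual σ),
      ¬ x.Parallel p₁ → ¬ x.Parallel p₂ → ¬ x.Parallel p₃ →
      {D | ∃ B ∈ blocks σ, p₁ ∈ B ∧ p₂ ∈ B ∧ p₃ ∈ B ∧ x ∈ B ∧ D = Φ σ '' B} =
        {D | ∃ U ∈ solidsThrough σ p₁ p₂ p₃ x,
          D = cone σ ∩ (U.projectivization : Set (ℙ K (Fin 6 → K)))} ∧
      (x ∈ trace σ p₁ p₂ p₃ → (solidsThrough σ p₁ p₂ p₃ x).ncard = Nat.card K) ∧
      (x ∉ trace σ p₁ p₂ p₃ → (∃ x' ∈ trace σ p₁ p₂ p₃, x.Parallel x') →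
        (solidsThrough σ p₁ p₂ p₃ x).ncard = 0) ∧
      (x ∉ trace σ p₁ p₂ p₃ → (¬ ∃ x' ∈ trace σ p₁ p₂ p₃, x.Parallel x') →
        (solidsThrough σ p₁ p₂ p₃ x).ncard = 1) := by
  obtain ⟨u, hu, hli, rfl, rfl, rfl⟩ := exists_generators h₁₂ h₁₃ h₂₃
  exact ⟨⟨finrank_plane hu hli, image_trace_eq hu hli⟩, fun x _ _ _ =>
    ⟨sections_eq _ _ _ x, ncard_solidsThrough_of_mem_trace hu hli,
      ncard_solidsThrough_of_parallel hu hli,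
      fun _ => ncard_solidsThrough_of_not_parallel hu hli⟩⟩
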